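/- Let $\mathcal H_1,\mathcal H_2$ be complex separable Hilbert spaces (scalar products linear in the second factor) and let $A:\operatorname{dom}(A)\subseteq\mathcal H_1\to\mathcal H_2$ be a densely defined, closed, linear operator, with $|A|=(A^*A)^{1/2}$. Products of unbounded operators are taken on their natural domains. Let $B:\operatorname{dom}(B)\subseteq\mathcal H_1\to\mathcal H_1$ be a closed linear operator which commutes with $|A|$ in the sense that $B|A|\subseteq|A|B$, and let $R$ be a densely defined, closable linear operator in $\mathcal H_1$ with $\operatorname{dom}(R)\supseteq\operatorname{dom}(A)$. Let $u:[0,\infty)\to\mathcal H_1$ be a classical solution of $$\ddot u+R\dot u+A^*Au=0,$$ that is, $u\in C^2([0,\infty);\mathcal H_1)$; for all $t\ge 0$, $u(t)\in\operatorname{dom}(A^*A)$ and $\dot u(t)\in\operatorname{dom}(R)$; $A^*Au,\,R\dot u\in C([0,\infty);\mathcal H_1)$; and the equation holds for all $t\ge0$ (derivatives at $t=0$ being one-sided). Assume moreover that $u(t)\in\operatorname{dom}(B|A|)$, $\dot u(t)\in\operatorname{dom}(B)$ and $R\dot u(t)\in\operatorname{dom}(B)$ for all $t\ge0$, and that $B|A|u(\cdot)\in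 C^1([0,\infty);\mathcal H_1)$ and $B\dot u(\cdot)\in C^1([0,\infty);\mathcal H_1)$. Then $u(t)\in\operatorname{dom}(AB)$ for all $t\ge0$, the function $t\mapsto\|B\dot u(t)\|_{\mathcal H_1}^2+\|ABu(t)\|_{\mathcal H_2}^2$ is differentiable on $[0,\infty)$, and for all $t\ge0$ $$\frac{d}{dt}\Big[\|B\dot u(t)\|_{\mathcal H_1}^2+\|ABu(t)\|_{\mathcal H_2}^2\Big]=-2\operatorname{Re}\big(B\dot u(t),BR\dot u(t)\big)_{\mathcal H_1}.$$ In particular, if $R=0$ (that is, $Rx=0$ for all $x\in\operatorname{dom}(R)$), then the right-hand side vanishes and $\|B\dot u(t)\|_{\mathcal H_1}^2+\|ABu(t)\|_{\mathcal H_2}^2$ is constant in $t\in[0,\infty)$. -/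

import Mathlib

open scoped InnerProductSpace

noncomputable section

namespace HilbertOp

section Basic

variable {E F G : Type*} [NormedAddCommGroup E] [InnerProductSpace ℂ E]
  [NormedAddCommGroup F] [InnerProductSpace ℂ F]
  [NormedAddCommGroup G] [InnerProductSpace ℂ G]

/-- The product `g f` of two unbounded operators on its natural domain
`{x ∈ dom f | f x ∈ dom g}`. -/
def mulOp (g : F →ₗ.[ℂ] G) (f : E →ₗ.[ℂ] F) : E →ₗ.[ℂ] G where
  domain :=
    { carrier := {x | ∃ h : x ∈ f.domain, f ⟨x, h⟩ ∈ g.domain}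
      zero_mem' := ⟨f.domain.zero_mem, by
        have h : f ⟨0, f.domain.zero_mem⟩ = 0 := f.map_zero
        rw [h]; exact g.domain.zero_mem⟩
      add_mem' := by
        rintro x y ⟨hx, hx'⟩ ⟨hy, hy'⟩
        refine ⟨f.domain.add_mem hx hy, ?_⟩
        have h : f ⟨x + y, f.domain.add_mem hx hy⟩ = f ⟨x, hx⟩ + f ⟨y, hy⟩ :=
          f.map_add ⟨x, hx⟩ ⟨y, hy⟩
        rw [h]; exact g.domain.add_mem hx' hy'
      smul_mem' := by
        rintro c x ⟨hx, hx'⟩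
        refine ⟨f.domain.smul_mem c hx, ?_⟩
        have h : f ⟨c • x, f.domain.smul_mem c hx⟩ = c • f ⟨x, hx⟩ :=
          f.map_smul c ⟨x, hx⟩
        rw [h]; exact g.domain.smul_mem c hx' }
  toFun :=
    { toFun := fun x => g ⟨f ⟨x, x.2.fst⟩, x.2.snd⟩
      map_add' := fun x y => by
        rw [← LinearPMap.map_add]
        congr 1
        exact Subtype.ext (f.map_add ⟨x, x.2.fst⟩ ⟨y, y.2.fst⟩)
      map_smul' := fun c x => by
        rw [RingHom.id_apply, ← LinearPMap.map_smul]
        congr 1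
        exact Subtype.ext (f.map_smul c ⟨x, x.2.fst⟩) }

open scoped Classical in
/-- The value `T x` of an unbounded operator, extended by `0` to vectors outside of `dom T`. It is
only used for vectors that are stated to be in `dom T`. -/
def val (T : E →ₗ.[ℂ] F) (x : E) : F :=
  if h : x ∈ T.domain then T ⟨x, h⟩ else 0

end Basic

section Modulus

variable {H K : Type*} [NormedAddCommGroup H] [InnerProductSpace ℂ H] [CompleteSpace H]
  [NormedAddCommGroup K] [InnerProductSpace ℂ K] [CompleteSpace K]

/-- `P` is a nonnegative self-adjoint square root of the unbounded operator `S`. -/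
structure IsNonnegSqrt (S P : H →ₗ.[ℂ] H) : Prop where
  isSelfAdjoint : IsSelfAdjoint P
  nonneg : ∀ x : P.domain, 0 ≤ (⟪(x : H), P x⟫_ℂ).re
  sq_eq : mulOp P P = S

/-- The operator `A* A` on its natural domain. -/
def adjMul (A : H →ₗ.[ℂ] K) : H →ₗ.[ℂ] H := mulOp A.adjoint A

open Classical in
/-- The modulus `|A| = (A* A)^{1/2}`: the (unique) nonnegative self-adjoint square root of `A* A`.
For densely defined closed `A` it exists, see `modulus_spec`; the value `0` is never used then. -/
def modulus (A : H →ₗ.[ℂ] K) : H →ₗ.[ℂ] H :=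
  if h : ∃ P, IsNonnegSqrt (adjMul A) P then h.choose else 0

/-- For a densely defined closed operator `A` there is a bounded self-adjoint `T` with
`0 ≤ T ≤ 1` that inverts `1 + A* A`. -/
theorem exists_resolvent (A : H →ₗ.[ℂ] K) (hd : Dense (A.domain : Set H)) (hc : A.IsClosed) :
    ∃ T : H →L[ℂ] H, 0 ≤ T ∧ 0 ≤ 1 - T ∧ Function.Injective T ∧
      ∀ x y, (x, y) ∈ (adjMul A).graph ↔ ∃ f, x = T f ∧ y = f - T f := by
  let g : Submodule ℂ (WithLp 2 (H × K)) :=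
    A.graph.comap (WithLp.linearEquiv 2 ℂ (H × K)).toLinearMap
  have hg : IsClosed (g : Set (WithLp 2 (H × K))) :=
    IsClosed.preimage (WithLp.prod_continuous_ofLp 2 H K) hc
  have : CompleteSpace g := hg.completeSpace_coe
  let p : g →L[ℂ] H := (WithLp.fstL 2 ℂ H K) ∘L g.subtypeL
  have hp : ∀ z : g, ‖p z‖ ≤ ‖z‖ := fun z => by
    have h1 : ‖(z : WithLp 2 (H × K)).fst‖ ^ 2 ≤ ‖(z : WithLp 2 (H × K))‖ ^ 2 := by
      rw [WithLp.prod_norm_sq_eq_of_L2]; nlinarith [sq_nonneg ‖(z : WithLp 2 (H × K)).snd‖]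
    exact (abs_le_of_sq_le_sq' h1 (norm_nonneg _)).2
  have hpn : ‖p‖ ≤ 1 := p.opNorm_le_bound zero_le_one fun z => by simpa using hp z
  let J := p.adjoint
  let T : H →L[ℂ] H := p ∘L J
  have hT0 : 0 ≤ T := by
    rw [ContinuousLinearMap.nonneg_iff_isPositive]
    exact ContinuousLinearMap.isPositive_self_comp_adjoint p
  have hT1 : 0 ≤ 1 - T := by
    rw [sub_nonneg, ← CStarAlgebra.norm_le_one_iff_of_nonneg T]
    refine (ContinuousLinearMap.opNorm_comp_le _ _).trans ?_
    have : ‖J‖ ≤ 1 := by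
      rw [show ‖J‖ = ‖p‖ from LinearIsometryEquiv.norm_map _ p]; exact hpn
    exact mul_le_one₀ hpn (norm_nonneg J) this
  -- the variational characterization of `T`
  have key : ∀ f, ∃ hf : T f ∈ A.domain, ∀ h : A.domain,
      ⟪f, (h : H)⟫_ℂ = ⟪T f, (h : H)⟫_ℂ + ⟪A ⟨T f, hf⟩, A h⟫_ℂ := by
    intro f
    have hm : ((T f, ((J f : g) : WithLp 2 (H × K)).snd) : H × K) ∈ A.graph := (J f).2
    rw [LinearPMap.mem_graph_iff] at hm
    obtain ⟨w, hw1, hw2⟩ := hm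
    have hw1' : (w : H) = T f := hw1
    have hf : T f ∈ A.domain := hw1' ▸ w.2
    have hw : w = ⟨T f, hf⟩ := Subtype.ext hw1'
    refine ⟨hf, fun h => ?_⟩
    let z : g := ⟨WithLp.toLp 2 ((h : H), A h), A.mem_graph h⟩
    have h1 : ⟪J f, z⟫_ℂ = ⟪f, p z⟫_ℂ := ContinuousLinearMap.adjoint_inner_left p z f
    rw [Submodule.coe_inner, WithLp.prod_inner_apply] at h1
    have h2 : A ⟨T f, hf⟩ = ((J f : g) : WithLp 2 (H × K)).snd := by rw [← hw]; exact hw2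
    rw [h2]
    exact h1.symm
  have hinj : Function.Injective T := by
    rw [injective_iff_map_eq_zero]
    intro f hf0
    obtain ⟨hf, h⟩ := key f
    apply hd.eq_zero_of_inner_left ℂ
    intro v hv
    have h2 : A ⟨T f, hf⟩ = 0 := by
      rw [show (⟨T f, hf⟩ : A.domain) = 0 from Subtype.ext hf0]; exact A.map_zero
    have h3 := h ⟨v, hv⟩
    rw [h2, hf0, inner_zero_left, inner_zero_left, add_zero] at h3
    exact h3
  refine ⟨T, hT0, hT1, hinj, fun x y => ?_⟩
  rw [LinearPMap.mem_graph_iff]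
  constructor
  · rintro ⟨⟨x', hx, hx'⟩, rfl, rfl⟩
    change ∃ f, x' = T f ∧ A.adjoint ⟨A ⟨x', hx⟩, hx'⟩ = f - T f
    set y := A.adjoint ⟨A ⟨x', hx⟩, hx'⟩ with hy
    obtain ⟨hf, h⟩ := key (x' + y)
    have h3 : ∀ k : A.domain, ⟪y, (k : H)⟫_ℂ = ⟪A ⟨x', hx⟩, A k⟫_ℂ :=
      fun k => LinearPMap.adjoint_isFormalAdjoint hd ⟨A ⟨x', hx⟩, hx'⟩ k
    have h4 : (⟨T (x' + y), hf⟩ - ⟨x', hx⟩ : A.domain) = 0 := by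
      set d : A.domain := ⟨T (x' + y), hf⟩ - ⟨x', hx⟩ with hdd
      have h5 := h d
      rw [inner_add_left, h3] at h5
      have h6 : (d : H) = T (x' + y) - x' := rfl
      have h7 : A d = A ⟨T (x' + y), hf⟩ - A ⟨x', hx⟩ := A.map_sub _ _
      have h8 : ⟪(d : H), (d : H)⟫_ℂ + ⟪A d, A d⟫_ℂ = 0 := by
        nth_rewrite 1 [h6]
        nth_rewrite 1 [h7]
        rw [inner_sub_left, inner_sub_left]
        linear_combination -h5
      have h9 : ‖(d : H)‖ ^ 2 + ‖A d‖ ^ 2 = 0 := by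
        rw [inner_self_eq_norm_sq_to_K, inner_self_eq_norm_sq_to_K] at h8
        have h8' : ((‖(d : H)‖ ^ 2 + ‖A d‖ ^ 2 : ℝ) : ℂ) = 0 := by
          push_cast; exact h8
        exact Complex.ofReal_eq_zero.mp h8'
      have h10 : ‖(d : H)‖ = 0 := by nlinarith [sq_nonneg ‖(d : H)‖, sq_nonneg ‖A d‖]
      exact Subtype.ext (norm_eq_zero.mp h10)
    have h11 : T (x' + y) - x' = 0 := congrArg Subtype.val h4
    rw [sub_eq_zero] at h11
    exact ⟨x' + y, h11.symm, by rw [h11]; abel⟩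
  · rintro ⟨f, rfl, rfl⟩
    obtain ⟨hf, h⟩ := key f
    have h1 : ∀ k : A.domain, ⟪f - T f, (k : H)⟫_ℂ = ⟪A ⟨T f, hf⟩, A k⟫_ℂ := fun k => by
      rw [inner_sub_left, h k]; ring
    have h2 : A ⟨T f, hf⟩ ∈ A.adjoint.domain :=
      LinearPMap.mem_adjoint_domain_of_exists _ ⟨_, h1⟩
    exact ⟨⟨T f, hf, h2⟩, rfl, LinearPMap.adjoint_apply_eq hd ⟨_, h2⟩ h1⟩

theorem exists_isNonnegSqrt (A : H →ₗ.[ℂ] K) (hd : Dense (A.domain : Set H)) (hc : A.IsClosed) :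
    ∃ P, IsNonnegSqrt (adjMul A) P := by
  obtain ⟨T, hT0, hT1, hinj, hgr⟩ := exists_resolvent A hd hc
  let C := CFC.sqrt T
  let S := CFC.sqrt (1 - T)
  have hC0 : 0 ≤ C := CFC.sqrt_nonneg T
  have hS0 : 0 ≤ S := CFC.sqrt_nonneg (1 - T)
  have hCC : C * C = T := CFC.sqrt_mul_sqrt_self T hT0
  have hSS : S * S = 1 - T := CFC.sqrt_mul_sqrt_self (1 - T) hT1
  have hcomm : Commute C S := by
    have h1 : Commute T (1 - T) := (Commute.one_right T).sub_right (Commute.refl T)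
    have h2 : Commute C (1 - T) := h1.cfcₙ_nnreal _
    exact (h2.symm.cfcₙ_nnreal _).symm
  have hCC' : ∀ x, C (C x) = T x := fun x => congrArg (fun L : H →L[ℂ] H => L x) hCC
  have hSS' : ∀ x, S (S x) = x - T x := fun x => congrArg (fun L : H →L[ℂ] H => L x) hSS
  have hCS : ∀ x, C (S x) = S (C x) := fun x => congrArg (fun L : H →L[ℂ] H => L x) hcomm.eq
  have hCp := (ContinuousLinearMap.nonneg_iff_isPositive C).mp hC0
  have hSp := (ContinuousLinearMap.nonneg_iff_isPositive S).mp hS0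
  have hCsym : ∀ x y, ⟪C x, y⟫_ℂ = ⟪x, C y⟫_ℂ := hCp.isSymmetric
  have hSsym : ∀ x y, ⟪S x, y⟫_ℂ = ⟪x, S y⟫_ℂ := hSp.isSymmetric
  have hCinj : Function.Injective C := fun x y h => hinj (by rw [← hCC', ← hCC', h])
  let e := LinearEquiv.ofInjective C.toLinearMap hCinj
  let P : H →ₗ.[ℂ] H := ⟨LinearMap.range C.toLinearMap, S.toLinearMap ∘ₗ e.symm.toLinearMap⟩
  have hPC : ∀ x, ∀ h : C x ∈ P.domain, P ⟨C x, h⟩ = S x := fun x h => by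
    change S (e.symm ⟨C x, h⟩) = S x
    have : (⟨C x, h⟩ : LinearMap.range C.toLinearMap) = e x := rfl
    rw [this, e.symm_apply_apply]
  have hmem : ∀ x, C x ∈ P.domain := fun x => ⟨x, rfl⟩
  have hdP : Dense (P.domain : Set H) := by
    rw [Submodule.dense_iff_topologicalClosure_eq_top,
      Submodule.topologicalClosure_eq_top_iff, Submodule.eq_bot_iff]
    intro x hx
    apply hCinj
    rw [map_zero, ← inner_self_eq_zero (𝕜 := ℂ), hCsym, ← inner_conj_symm, hx _ (hmem _), map_zero]
  refine ⟨P, ?_, ?_, ?_⟩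
  · rw [LinearPMap.isSelfAdjoint_def]
    apply le_antisymm
    · have hm : ∀ y : P.adjoint.domain, ∃ x, (y : H) = C x ∧ P.adjoint y = S x := by
        intro y
        have h1 : C (P.adjoint y) = S y := by
          apply ext_inner_right ℂ
          intro v
          rw [hCsym, hSsym, LinearPMap.adjoint_isFormalAdjoint hdP y ⟨C v, hmem v⟩, hPC]
        refine ⟨C y + S (P.adjoint y), ?_, ?_⟩
        · rw [map_add, hCC', hCS, h1, hSS']; abel
        · rw [map_add, ← hCS, ← h1, hCC', hSS']; abel
      constructor
      · intro y hy
        obtain ⟨x, hx, -⟩ := hm ⟨y, hy⟩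
        change y = C x at hx
        rw [hx]; exact hmem x
      · rintro y ⟨z, hz⟩ hyz
        obtain ⟨x, hx, hx'⟩ := hm y
        rw [hx']
        have hzx : z = C x := by rw [← hx, hyz]
        subst hzx
        exact (hPC x hz).symm
    · apply LinearPMap.IsFormalAdjoint.le_adjoint hdP
      rintro ⟨_, x, rfl⟩ ⟨_, y, rfl⟩
      change ⟪P ⟨C x, hmem x⟩, C y⟫_ℂ = ⟪C x, P ⟨C y, hmem y⟩⟫_ℂ
      rw [hPC, hPC, hSsym, ← hCS, hCsym]
  · rintro ⟨_, x, rfl⟩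
    change 0 ≤ (⟪C x, P ⟨C x, hmem x⟩⟫_ℂ).re
    rw [hPC, hCsym]
    have h := (ContinuousLinearMap.nonneg_iff_isPositive (C * S)).mp (hcomm.mul_nonneg hC0 hS0)
    exact h.re_inner_nonneg_right x
  · apply LinearPMap.eq_of_eq_graph
    ext ⟨x, y⟩
    rw [hgr, LinearPMap.mem_graph_iff]
    constructor
    · rintro ⟨⟨_, ⟨x, rfl⟩, hx'⟩, rfl, rfl⟩
      change ∃ f, C x = T f ∧ P ⟨P ⟨C x, hmem x⟩, hx'⟩ = f - T f
      obtain ⟨z, hz⟩ := id hx'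
      change C z = P ⟨C x, hmem x⟩ at hz
      have hz' : C z = S x := by rw [hz, hPC]
      have hxe : x = C (C x + S z) := by
        rw [map_add, hCC', hCS, hz', hSS']; abel
      have hze : z = S (C x + S z) := by
        apply hCinj; rw [hCS, ← hxe, hz']
      refine ⟨C x + S z, by rw [← hCC', ← hxe], ?_⟩
      have : P ⟨P ⟨C x, hmem x⟩, hx'⟩ = P ⟨C z, hmem z⟩ := by congr 1; exact Subtype.ext hz.symm
      rw [this, hPC, ← hSS', ← hze]
    · rintro ⟨f, rfl, rfl⟩
      have h1 : P ⟨C (C f), hmem _⟩ = C (S f) := by rw [hPC, hCS]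
      have h2 : P ⟨C (C f), hmem _⟩ ∈ P.domain := by rw [h1]; exact hmem _
      refine ⟨⟨C (C f), hmem _, h2⟩, hCC' f, ?_⟩
      change P ⟨P ⟨C (C f), hmem _⟩, h2⟩ = _
      have : P ⟨P ⟨C (C f), hmem _⟩, h2⟩ = P ⟨C (S f), hmem _⟩ := by
        congr 1; exact Subtype.ext h1
      rw [this, hPC, hSS']

theorem modulus_spec (A : H →ₗ.[ℂ] K) (hd : Dense (A.domain : Set H)) (hc : A.IsClosed) :
    IsNonnegSqrt (adjMul A) (modulus A) := by
  have h := exists_isNonnegSqrt A hd hc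
  rw [modulus, dif_pos h]
  exact h.choose_spec

end Modulus

section Wave

variable {H : Type*} [NormedAddCommGroup H] [InnerProductSpace ℂ H]

/-- The derivative on `[0, ∞)`, one-sided at `0`. -/
def dt (u : ℝ → H) : ℝ → H := derivWithin u (Set.Ici 0)

/-- `t ↦ T (v t)` belongs to `C¹([0, ∞); F)`; in particular `v t ∈ dom T` for all `t ≥ 0`. -/
def MapsC1 {F : Type*} [NormedAddCommGroup F] [InnerProductSpace ℂ F]
    (T : H →ₗ.[ℂ] F) (v : ℝ → H) : Prop :=
  (∀ t, 0 ≤ t → v t ∈ T.domain) ∧ ContDiffOn ℝ 1 (fun t => val T (v t)) (Set.Ici 0)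

/-- Classical solutions `u : [0, ∞) → H` of `u'' + R u' + S u = 0`. Only the values of `u` on
`[0, ∞)` matter. -/
structure IsClassicalSolution (R S : H →ₗ.[ℂ] H) (u : ℝ → H) : Prop where
  contDiffOn : ContDiffOn ℝ 2 u (Set.Ici 0)
  mem_stiffness : ∀ t, 0 ≤ t → u t ∈ S.domain
  continuousOn_stiffness : ContinuousOn (fun t => val S (u t)) (Set.Ici 0)
  mem_damping : ∀ t, 0 ≤ t → dt u t ∈ R.domain
  continuousOn_damping : ContinuousOn (fun t => val R (dt u t)) (Set.Ici 0)
  equation : ∀ t, 0 ≤ t → dt (dt u) t + val R (dt u t) + val S (u t) = 0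

end Wave

end HilbertOp

end

namespace HilbertOp

/-! ### Unbounded operators through their graphs -/

section Graph

variable {E F G : Type*} [NormedAddCommGroup E] [InnerProductSpace ℂ E]
  [NormedAddCommGroup F] [InnerProductSpace ℂ F]
  [NormedAddCommGroup G] [InnerProductSpace ℂ G]

/-! Write P = |A|, f = BPu and g = Bu'. Commutation gives f = PBu, and
`IsNonnegSqrt.exists_mem_graph` gives ‖ABu‖ = ‖PBu‖ = ‖f‖, so the energy is ‖g‖² + ‖f‖², a sum of
squares of C¹ curves.

Closedness of B gives Bu'' = g' and (Bu)' = g (`mem_graph_of_hasDerivWithinAt`,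
`hasDerivWithinAt_of_mem_graph`). The equation then puts P²u = A*Au in dom B, and commutation
applied to Pu shows f ∈ dom P with Pf = -g' - BRu'. Differentiating (f(t), PBu(s)) = (Pf(t), Bu(s))
in s at s = t yields (f, f') = (Pf, g). Hence Re(g, g') + Re(f, f') = -Re(g, BRu'), which is half
the claimed derivative. -/

theorem mem_graph_val {T : E →ₗ.[ℂ] F} {x : E} (hx : x ∈ T.domain) : (x, val T x) ∈ T.graph := by
  rw [val, dif_pos hx]
  exact T.mem_graph ⟨x, hx⟩

theorem mem_domain_of_mem_graph {T : E →ₗ.[ℂ] F} {x : E} {y : F} (h : (x, y) ∈ T.graph) :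
    x ∈ T.domain := by
  obtain ⟨w, rfl, -⟩ := (T.mem_graph_iff).mp h
  exact w.2

theorem val_eq_of_mem_graph {T : E →ₗ.[ℂ] F} {x : E} {y : F} (h : (x, y) ∈ T.graph) :
    val T x = y :=
  T.mem_graph_snd_inj (mem_graph_val (mem_domain_of_mem_graph h)) h rfl

theorem mem_graph_mulOp {g : F →ₗ.[ℂ] G} {f : E →ₗ.[ℂ] F} {x : E} {z : G} :
    (x, z) ∈ (mulOp g f).graph ↔ ∃ y, (x, y) ∈ f.graph ∧ (y, z) ∈ g.graph := by
  constructor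
  · intro h
    obtain ⟨⟨x', hx, hx'⟩, rfl, rfl⟩ := (LinearPMap.mem_graph_iff _).mp h
    exact ⟨f ⟨x', hx⟩, f.mem_graph ⟨x', hx⟩, g.mem_graph ⟨_, hx'⟩⟩
  · rintro ⟨y, hxy, hyz⟩
    obtain ⟨⟨x', hx⟩, rfl, rfl⟩ := (LinearPMap.mem_graph_iff _).mp hxy
    have hd : f ⟨x', hx⟩ ∈ g.domain := mem_domain_of_mem_graph hyz
    have h1 : g ⟨_, hd⟩ = z := g.mem_graph_snd_inj (g.mem_graph ⟨_, hd⟩) hyz rfl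
    exact h1 ▸ (mulOp g f).mem_graph ⟨x', hx, hd⟩

theorem mem_graph_of_le {S T : E →ₗ.[ℂ] F} (hST : S ≤ T) {x : E} {y : F} (h : (x, y) ∈ S.graph) :
    (x, y) ∈ T.graph :=
  LinearPMap.le_graph_of_le hST h

theorem inner_graph_adjoint [CompleteSpace E] {A : E →ₗ.[ℂ] F}
    (hd : Dense (A.domain : Set E)) {x : E} {y v : F} {w : E}
    (hx : (x, y) ∈ A.graph) (hv : (v, w) ∈ A.adjoint.graph) :
    ⟪w, x⟫_ℂ = ⟪v, y⟫_ℂ := by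
  obtain ⟨x', rfl, rfl⟩ := (LinearPMap.mem_graph_iff _).mp hx
  obtain ⟨v', rfl, rfl⟩ := (LinearPMap.mem_graph_iff _).mp hv
  exact LinearPMap.adjoint_isFormalAdjoint hd v' x'

end Graph

/-! ### A core for A, and the equality ‖Ax‖ = ‖|A|x‖ -/

section Core

variable {H K : Type*} [NormedAddCommGroup H] [InnerProductSpace ℂ H] [CompleteSpace H]
  [NormedAddCommGroup K] [InnerProductSpace ℂ K] [CompleteSpace K]

/-- The domain of `A* A` is a core of the densely defined closed operator `A`. -/
theorem graph_subset_closure_adjMul (A : H →ₗ.[ℂ] K) (hd : Dense (A.domain : Set H))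
    (hc : A.IsClosed) :
    (A.graph : Set (H × K)) ⊆ closure {z | z ∈ A.graph ∧ z.1 ∈ (adjMul A).domain} := by
  obtain ⟨T, -, -, -, hT⟩ := exists_resolvent A hd hc
  let e := WithLp.prodContinuousLinearEquiv 2 ℂ H K
  let D : Submodule ℂ (H × K) :=
    -- The product carries the sup norm, so the orthogonal decomposition is done in its L² copy,
    -- which has the same topology.
    A.graph ⊓ (adjMul A).domain.comap (LinearMap.fst ℂ H K)
  let M : Submodule ℂ (WithLp 2 (H × K)) := D.topologicalClosure.comap e.toLinearMap
  have hM : IsClosed (M : Set (WithLp 2 (H × K))) :=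
    D.isClosed_topologicalClosure.preimage e.continuous
  have : CompleteSpace M := hM.completeSpace_coe
  have hDA : D.topologicalClosure ≤ A.graph := D.topologicalClosure_minimal inf_le_left hc
  rintro ⟨x, y⟩ hxy
  change (x, y) ∈ D.topologicalClosure
  obtain ⟨p, hp, q, hq, hpq⟩ := M.exists_add_mem_mem_orthogonal (WithLp.toLp 2 (x, y))
  have hqA : (q.fst, q.snd) ∈ A.graph := by
    have h1 : e q = (x, y) - e p := by
      rw [eq_sub_iff_add_eq, add_comm, ← map_add, ← hpq]; rfl
    change e q ∈ A.graph
    rw [h1]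
    exact A.graph.sub_mem hxy (hDA hp)
  have hq0 : q.fst = 0 := by
    rw [← inner_self_eq_zero (𝕜 := ℂ)]
    have hg : (T q.fst, q.fst - T q.fst) ∈ (adjMul A).graph := (hT _ _).mpr ⟨_, rfl, rfl⟩
    obtain ⟨w, hw1, hw2⟩ := mem_graph_mulOp.mp hg
    have h1 : WithLp.toLp 2 (T q.fst, w) ∈ M :=
      D.le_topologicalClosure ⟨hw1, mem_domain_of_mem_graph hg⟩
    have h2 := hq _ h1
    rw [WithLp.prod_inner_apply] at h2
    have h3 := inner_graph_adjoint hd hqA hw2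
    have h4 : ⟪T q.fst, q.fst⟫_ℂ + ⟪w, q.snd⟫_ℂ = 0 := h2
    rw [← h3, ← inner_add_left, add_sub_cancel] at h4
    exact h4
  have hq1 : q.snd = 0 := A.graph_fst_eq_zero_snd hqA hq0
  have h5 : (x, y) = e p := by
    have h6 : e q = 0 := Prod.ext hq0 hq1
    rw [← add_zero (e p), ← h6, ← map_add, ← hpq]; rfl
  rw [h5]
  exact hp

/-- `dom P ⊆ dom A` and `‖A x‖ = ‖P x‖` for every nonnegative self-adjoint square root `P` of
`A* A`. -/
theorem IsNonnegSqrt.exists_mem_graph {A : H →ₗ.[ℂ] K} (hd : Dense (A.domain : Set H))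
    (hc : A.IsClosed) {P : H →ₗ.[ℂ] H} (hP : IsNonnegSqrt (adjMul A) P) {x y : H}
    (h : (x, y) ∈ P.graph) : ∃ z, (x, z) ∈ A.graph ∧ ‖z‖ = ‖y‖ := by
  have hPd := hP.isSelfAdjoint.dense_domain
  have hadj : P.adjoint = P := hP.isSelfAdjoint
  have hSP : adjMul P = adjMul A := by rw [adjMul, hadj, hP.sq_eq]
  have hnorm : ∀ a b, (a, b) ∈ P.graph → a ∈ (adjMul A).domain →
      ∃ c, (a, c) ∈ A.graph ∧ ‖c‖ = ‖b‖ := by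
    intro a b hab ha
    have hs := mem_graph_val ha
    obtain ⟨c, hc1, hc2⟩ := mem_graph_mulOp.mp hs
    rw [← hSP] at hs
    obtain ⟨b', hb1, hb2⟩ := mem_graph_mulOp.mp hs
    obtain rfl : b = b' := P.mem_graph_snd_inj hab hb1 rfl
    refine ⟨c, hc1, ?_⟩
    have h1 := (inner_graph_adjoint hd hc1 hc2).symm.trans (inner_graph_adjoint hPd hb1
      (by rw [hSP] at hb2; exact hb2))
    rw [inner_self_eq_norm_sq_to_K, inner_self_eq_norm_sq_to_K] at h1
    have h2 : ‖c‖ ^ 2 = ‖b‖ ^ 2 := by exact_mod_cast h1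
    exact (sq_eq_sq₀ (norm_nonneg _) (norm_nonneg _)).mp h2
  obtain ⟨s, hs, hlim⟩ := mem_closure_iff_seq_limit.mp
    (graph_subset_closure_adjMul P hPd hP.isSelfAdjoint.isClosed h)
  rw [hSP] at hs
  choose c hcA hcn using fun n => hnorm (s n).1 (s n).2 (hs n).1 (hs n).2
  have hlim1 : Filter.Tendsto (fun n => (s n).1) Filter.atTop (nhds x) :=
    (continuous_fst.tendsto _).comp hlim
  have hlim2 : Filter.Tendsto (fun n => (s n).2) Filter.atTop (nhds y) :=
    (continuous_snd.tendsto _).comp hlim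
  have hdist : ∀ m n, dist (c m) (c n) = dist (s m).2 (s n).2 := by
    intro m n
    obtain ⟨d, hd1, hd2⟩ := hnorm _ _ (P.graph.sub_mem (hs m).1 (hs n).1)
      ((adjMul A).domain.sub_mem (hs m).2 (hs n).2)
    have h1 : d = c m - c n :=
      A.mem_graph_snd_inj hd1 (A.graph.sub_mem (hcA m) (hcA n)) rfl
    rw [dist_eq_norm, dist_eq_norm, ← h1, hd2]
  have hcau : CauchySeq c := by
    rw [Metric.cauchySeq_iff']
    simp_rw [hdist]
    exact Metric.cauchySeq_iff'.mp hlim2.cauchySeq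
  obtain ⟨z, hz⟩ := cauchySeq_tendsto_of_complete hcau
  refine ⟨z, hc.mem_of_tendsto (hlim1.prodMk_nhds hz) (Filter.Eventually.of_forall hcA), ?_⟩
  refine tendsto_nhds_unique hz.norm ?_
  simp_rw [hcn]
  exact hlim2.norm

end Core

/-! ### Differentiation on the half-line and closed subspaces -/

section Calculus

theorem hasDerivWithinAt_zero_eq_of_nonneg {F : Type*} [NormedAddCommGroup F] [NormedSpace ℝ F]
    {f : ℝ → F} (hf : ∀ t, 0 ≤ t → HasDerivWithinAt f 0 (Set.Ici 0) t) {t : ℝ} (ht : 0 ≤ t) :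
    f t = f 0 :=
  constant_of_has_deriv_right_zero
    (fun s hs => ((hf s hs.1).continuousWithinAt).mono Set.Icc_subset_Ici_self)
    (fun s hs => (hf s hs.1).mono (Set.Ici_subset_Ici.mpr hs.1)) t ⟨ht, le_rfl⟩

variable {V : Type*} [NormedAddCommGroup V] [NormedSpace ℝ V]

/-- The derivative of a curve in a closed subspace stays in that subspace. -/
theorem mem_of_hasDerivWithinAt {M : Submodule ℝ V} (hM : IsClosed (M : Set V)) {f : ℝ → V}
    {f' : V} (hf : ∀ t, 0 ≤ t → f t ∈ M) {t : ℝ} (ht : 0 ≤ t)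
    (h : HasDerivWithinAt f f' (Set.Ici 0) t) : f' ∈ M := by
  have h1 : HasDerivWithinAt (fun s => M.mkQL (f s)) (M.mkQL f') (Set.Ici 0) t :=
    M.mkQL.hasFDerivAt.comp_hasDerivWithinAt t h
  have h2 : HasDerivWithinAt (fun s => M.mkQL (f s)) 0 (Set.Ici 0) t :=
    (hasDerivWithinAt_const t (Set.Ici 0) (0 : V ⧸ M)).congr
      (fun s hs => (Submodule.Quotient.mk_eq_zero M).mpr (hf s hs))
      ((Submodule.Quotient.mk_eq_zero M).mpr (hf t ht))
  exact (Submodule.Quotient.mk_eq_zero M).mp (((uniqueDiffOn_Ici 0) t ht).eq_deriv _ h1 h2)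

/-- A curve whose derivative lies in a closed subspace only moves along that subspace. -/
theorem sub_mem_of_hasDerivWithinAt {M : Submodule ℝ V} (hM : IsClosed (M : Set V))
    {f f' : ℝ → V} (hf : ∀ t, 0 ≤ t → HasDerivWithinAt f (f' t) (Set.Ici 0) t)
    (hf' : ∀ t, 0 ≤ t → f' t ∈ M) {t : ℝ} (ht : 0 ≤ t) : f t - f 0 ∈ M := by
  have h1 : ∀ t, 0 ≤ t → HasDerivWithinAt (fun s => M.mkQL (f s)) 0 (Set.Ici 0) t := by
    intro t ht
    have h := M.mkQL.hasFDerivAt.comp_hasDerivWithinAt t (hf t ht)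
    rwa [show M.mkQL (f' t) = 0 from (Submodule.Quotient.mk_eq_zero M).mpr (hf' t ht)] at h
  have h2 := hasDerivWithinAt_zero_eq_of_nonneg h1 ht
  exact (Submodule.Quotient.eq M).mp h2

theorem exists_hasDerivWithinAt_Ici [CompleteSpace V] {g : ℝ → V}
    (hg : ContinuousOn g (Set.Ici 0)) :
    ∃ w : ℝ → V, ∀ t, 0 ≤ t → HasDerivWithinAt w (g t) (Set.Ici 0) t := by
  -- Freezing g at g(0) for negative times extends it continuously to the line, so its integral is
  -- differentiable at 0 too.
  have hc : Continuous fun t => g (max 0 t) :=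
    hg.comp_continuous (continuous_const.max continuous_id) fun t => le_max_left 0 t
  refine ⟨fun t => ∫ s in (0 : ℝ)..t, g (max 0 s), fun t ht => ?_⟩
  have h := (hc.integral_hasStrictDerivAt 0 t).hasDerivAt.hasDerivWithinAt (s := Set.Ici 0)
  rwa [max_eq_right ht] at h

end Calculus

/-! ### Closed operators applied to differentiable curves -/

section ClosedOperator

variable {E F : Type*} [NormedAddCommGroup E] [InnerProductSpace ℂ E]
  [NormedAddCommGroup F] [InnerProductSpace ℂ F]

theorem mem_graph_of_hasDerivWithinAt {T : E →ₗ.[ℂ] F} (hT : T.IsClosed) {v : ℝ → E} {g : ℝ → F}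
    {v' : E} {g' : F} (hv : ∀ t, 0 ≤ t → (v t, g t) ∈ T.graph) {t : ℝ} (ht : 0 ≤ t)
    (h : HasDerivWithinAt v v' (Set.Ici 0) t) (h' : HasDerivWithinAt g g' (Set.Ici 0) t) :
    (v', g') ∈ T.graph :=
  mem_of_hasDerivWithinAt (M := T.graph.restrictScalars ℝ) hT hv ht (h.prodMk h')

/-- A closed operator commutes with differentiation as soon as it maps the derivative to a
continuous function. -/
theorem hasDerivWithinAt_of_mem_graph [CompleteSpace F] {T : E →ₗ.[ℂ] F} (hT : T.IsClosed)
    {u v : ℝ → E} {b g : ℝ → F} (hb : ∀ t, 0 ≤ t → (u t, b t) ∈ T.graph)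
    (hu : ∀ t, 0 ≤ t → HasDerivWithinAt u (v t) (Set.Ici 0) t)
    (hg : ∀ t, 0 ≤ t → (v t, g t) ∈ T.graph) (hgc : ContinuousOn g (Set.Ici 0))
    {t : ℝ} (ht : 0 ≤ t) : HasDerivWithinAt b (g t) (Set.Ici 0) t := by
  obtain ⟨w, hw⟩ := exists_hasDerivWithinAt_Ici hgc
  have h1 : ∀ s, 0 ≤ s → b s = w s + (b 0 - w 0) := by
    intro s hs
    have h2 : (u s - u 0, w s - w 0) ∈ T.graph :=
      sub_mem_of_hasDerivWithinAt (M := T.graph.restrictScalars ℝ) hT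
        (f := fun t => (u t, w t)) (fun t ht => (hu t ht).prodMk (hw t ht)) hg hs
    have h3 : b s - b 0 = w s - w 0 :=
      T.mem_graph_snd_inj (T.graph.sub_mem (hb s hs) (hb 0 le_rfl)) h2 rfl
    rw [sub_eq_iff_eq_add] at h3
    rw [h3]; abel
  exact ((hw t ht).add_const _).congr h1 (h1 t ht)

end ClosedOperator

end HilbertOp

/-! ### The energy identity -/

open HilbertOp in
theorem lemma5p7 {H₁ H₂ : Type*}
    [NormedAddCommGroup H₁] [InnerProductSpace ℂ H₁] [CompleteSpace H₁]
    [TopologicalSpace.SeparableSpace H₁]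
    [NormedAddCommGroup H₂] [InnerProductSpace ℂ H₂] [CompleteSpace H₂]
    [TopologicalSpace.SeparableSpace H₂]
    (A : H₁ →ₗ.[ℂ] H₂) (hA_dense : Dense (A.domain : Set H₁)) (hA_closed : A.IsClosed)
    (B : H₁ →ₗ.[ℂ] H₁) (hB_closed : B.IsClosed)
    (hB_comm : mulOp B (modulus A) ≤ mulOp (modulus A) B)
    (R : H₁ →ₗ.[ℂ] H₁) (hR_dense : Dense (R.domain : Set H₁)) (hR_closable : R.IsClosable)
    (hR_dom : A.domain ≤ R.domain)
    (u : ℝ → H₁) (hu : IsClassicalSolution R (adjMul A) u)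
    (hBAu : MapsC1 (mulOp B (modulus A)) u)
    (hBu' : MapsC1 B (dt u))
    (hRu' : ∀ t, 0 ≤ t → dt u t ∈ (mulOp B R).domain) :
    (∀ t, 0 ≤ t → u t ∈ (mulOp A B).domain) ∧
    (∀ t, 0 ≤ t →
      HasDerivWithinAt (fun s => ‖val B (dt u s)‖ ^ 2 + ‖val (mulOp A B) (u s)‖ ^ 2)
        (-2 * (inner ℂ (val B (dt u t)) (val (mulOp B R) (dt u t))).re) (Set.Ici 0) t) ∧
    ((∀ x : R.domain, R x = 0) →
      (∀ t, 0 ≤ t → -2 * (inner ℂ (val B (dt u t)) (val (mulOp B R) (dt u t))).re = 0) ∧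
      ∀ t, 0 ≤ t →
        ‖val B (dt u t)‖ ^ 2 + ‖val (mulOp A B) (u t)‖ ^ 2 =
          ‖val B (dt u 0)‖ ^ 2 + ‖val (mulOp A B) (u 0)‖ ^ 2) := by
  have hP := modulus_spec A hA_dense hA_closed
  -- Only the square-root properties of |A| matter, not how it was chosen.
  generalize modulus A = P at *
  have hPd := hP.isSelfAdjoint.dense_domain
  have hadj : P.adjoint = P := hP.isSelfAdjoint
  obtain ⟨hfd, hfc⟩ := hBAu
  obtain ⟨hgd, hgc⟩ := hBu'
  set f : ℝ → H₁ := fun t => val (mulOp B P) (u t) with hf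
  set g : ℝ → H₁ := fun t => val B (dt u t) with hg
  have hPBu : ∀ t, 0 ≤ t → ∃ b, (u t, b) ∈ B.graph ∧ (b, f t) ∈ P.graph := fun t ht =>
    mem_graph_mulOp.mp (mem_graph_of_le hB_comm (mem_graph_val (hfd t ht)))
  have hBu : ∀ t, 0 ≤ t → (u t, val B (u t)) ∈ B.graph := fun t ht =>
    let ⟨_, h, _⟩ := hPBu t ht
    mem_graph_val (mem_domain_of_mem_graph h)
  have hPf : ∀ t, 0 ≤ t → (val B (u t), f t) ∈ P.graph := fun t ht => by
    obtain ⟨b, h1, h2⟩ := hPBu t ht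
    rwa [val_eq_of_mem_graph h1]
  have hABu : ∀ t, 0 ≤ t → ∃ z, (u t, z) ∈ (mulOp A B).graph ∧ ‖z‖ = ‖f t‖ := fun t ht => by
    obtain ⟨z, hz, hn⟩ := hP.exists_mem_graph hA_dense hA_closed (hPf t ht)
    exact ⟨z, mem_graph_mulOp.mpr ⟨_, hBu t ht, hz⟩, hn⟩
  have hnorm : ∀ t, 0 ≤ t → ‖val (mulOp A B) (u t)‖ = ‖f t‖ := fun t ht => by
    obtain ⟨z, hz, hn⟩ := hABu t ht
    rw [val_eq_of_mem_graph hz, hn]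
  have hu1 : ∀ t, 0 ≤ t → HasDerivWithinAt u (dt u t) (Set.Ici 0) t := fun t ht =>
    ((hu.contDiffOn.differentiableOn (by norm_num)) t ht).hasDerivWithinAt
  have hu2 : ∀ t, 0 ≤ t → HasDerivWithinAt (dt u) (dt (dt u) t) (Set.Ici 0) t := fun t ht =>
    ((hu.contDiffOn.derivWithin (m := 1) (uniqueDiffOn_Ici 0) (by norm_num)).differentiableOn
      (by norm_num) t ht).hasDerivWithinAt
  have hf1 : ∀ t, 0 ≤ t → HasDerivWithinAt f (dt f t) (Set.Ici 0) t := fun t ht =>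
    (hfc.differentiableOn (by norm_num) t ht).hasDerivWithinAt
  have hg1 : ∀ t, 0 ≤ t → HasDerivWithinAt g (dt g t) (Set.Ici 0) t := fun t ht =>
    (hgc.differentiableOn (by norm_num) t ht).hasDerivWithinAt
  have hgB : ∀ t, 0 ≤ t → (dt u t, g t) ∈ B.graph := fun t ht => mem_graph_val (hgd t ht)
  have hg' : ∀ t, 0 ≤ t → (dt (dt u) t, dt g t) ∈ B.graph := fun t ht =>
    mem_graph_of_hasDerivWithinAt hB_closed hgB ht (hu2 t ht) (hg1 t ht)
  have hb1 : ∀ t, 0 ≤ t → HasDerivWithinAt (fun s => val B (u s)) (g t) (Set.Ici 0) t :=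
    fun t ht => hasDerivWithinAt_of_mem_graph hB_closed hBu hu1 hgB hgc.continuousOn ht
  have hBR : ∀ t, 0 ≤ t → (val R (dt u t), val (mulOp B R) (dt u t)) ∈ B.graph := fun t ht => by
    obtain ⟨r, hr, hr'⟩ := mem_graph_mulOp.mp (mem_graph_val (hRu' t ht))
    rwa [val_eq_of_mem_graph hr]
  have hBS : ∀ t, 0 ≤ t →
      (val (adjMul A) (u t), -dt g t - val (mulOp B R) (dt u t)) ∈ B.graph := fun t ht => by
    have h1 : val (adjMul A) (u t) = -dt (dt u) t - val R (dt u t) := by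
      rw [sub_eq_add_neg, ← neg_add]
      exact (neg_eq_of_add_eq_zero_right (hu.equation t ht)).symm
    rw [h1]
    exact B.graph.sub_mem (B.graph.neg_mem (hg' t ht)) (hBR t ht)
  -- Commutation is used at Pu rather than u: BP(Pu) = BA*Au is known, and it must equal PB(Pu) =
  -- Pf.
  have hPf' : ∀ t, 0 ≤ t →
      (f t, -dt g t - val (mulOp B R) (dt u t)) ∈ P.graph := fun t ht => by
    have h1 := mem_graph_val (hu.mem_stiffness t ht)
    rw [← hP.sq_eq] at h1
    obtain ⟨p, hp1, hp2⟩ := mem_graph_mulOp.mp h1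
    rw [hP.sq_eq] at hp2
    obtain ⟨p', hp1', hpf⟩ := mem_graph_mulOp.mp (mem_graph_val (hfd t ht))
    obtain rfl : p = p' := P.mem_graph_snd_inj hp1 hp1' rfl
    obtain ⟨b, hb, hb'⟩ :=
      mem_graph_mulOp.mp (mem_graph_of_le hB_comm (mem_graph_mulOp.mpr ⟨_, hp2, hBS t ht⟩))
    obtain rfl : f t = b := B.mem_graph_snd_inj hpf hb rfl
    exact hb'
  -- The left slot is frozen at time t, so P never has to be applied to g.
  have hff' : ∀ t, 0 ≤ t →
      ⟪f t, dt f t⟫_ℂ = ⟪-dt g t - val (mulOp B R) (dt u t), g t⟫_ℂ := fun t ht => by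
    have h1 := (hasDerivWithinAt_const t (Set.Ici 0) (f t)).inner ℂ (hf1 t ht)
    have h2 := (hasDerivWithinAt_const t (Set.Ici 0)
      (-dt g t - val (mulOp B R) (dt u t))).inner ℂ (hb1 t ht)
    have h3 : ∀ s ∈ Set.Ici (0 : ℝ),
        ⟪f t, f s⟫_ℂ = ⟪-dt g t - val (mulOp B R) (dt u t), val B (u s)⟫_ℂ := fun s hs =>
      (inner_graph_adjoint hPd (hPf s hs) (by rw [hadj]; exact hPf' t ht)).symm
    have h4 := (uniqueDiffOn_Ici (0 : ℝ) t ht).eq_deriv _ h1 (h2.congr h3 (h3 t ht))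
    simpa only [inner_zero_left, add_zero] using h4
  have hsq : ∀ (k : ℝ → H₁) (t : ℝ), HasDerivWithinAt k (dt k t) (Set.Ici 0) t →
      HasDerivWithinAt (fun s => ‖k s‖ ^ 2) (2 * (⟪k t, dt k t⟫_ℂ).re) (Set.Ici 0) t := by
    intro k t hk
    have h1 := Complex.reCLM.hasFDerivAt.comp_hasDerivWithinAt t (hk.inner ℂ hk)
    have h2 : Complex.reCLM (⟪k t, dt k t⟫_ℂ + ⟪dt k t, k t⟫_ℂ) = 2 * (⟪k t, dt k t⟫_ℂ).re := by
      have h3 : (⟪dt k t, k t⟫_ℂ).re = (⟪k t, dt k t⟫_ℂ).re := inner_re_symm (𝕜 := ℂ) _ _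
      rw [Complex.reCLM_apply, Complex.add_re, h3]; ring
    rw [h2] at h1
    refine h1.congr_of_eventuallyEq (Filter.Eventually.of_forall fun s => ?_) ?_ <;>
      exact (inner_self_eq_norm_sq (𝕜 := ℂ) _).symm
  have hderiv : ∀ t, 0 ≤ t →
      HasDerivWithinAt (fun s => ‖g s‖ ^ 2 + ‖val (mulOp A B) (u s)‖ ^ 2)
        (-2 * (⟪g t, val (mulOp B R) (dt u t)⟫_ℂ).re) (Set.Ici 0) t := fun t ht => by
    have h1 := (hsq g t (hg1 t ht)).add (hsq f t (hf1 t ht))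
    have h2 : 2 * (⟪g t, dt g t⟫_ℂ).re + 2 * (⟪f t, dt f t⟫_ℂ).re =
        -2 * (⟪g t, val (mulOp B R) (dt u t)⟫_ℂ).re := by
      have h3 : (⟪-dt g t - val (mulOp B R) (dt u t), g t⟫_ℂ).re =
          (⟪g t, -dt g t - val (mulOp B R) (dt u t)⟫_ℂ).re := inner_re_symm (𝕜 := ℂ) _ _
      rw [hff' t ht, h3, inner_sub_right, inner_neg_right, Complex.sub_re, Complex.neg_re]
      ring
    rw [h2] at h1
    refine h1.congr (fun s hs => ?_) ?_
    · rw [hnorm s hs]; rfl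
    · rw [hnorm t ht]; rfl
  refine ⟨fun t ht => ?_, hderiv, fun hR0 => ?_⟩
  · obtain ⟨z, hz, -⟩ := hABu t ht
    exact mem_domain_of_mem_graph hz
  · have hzero : ∀ t, 0 ≤ t → -2 * (⟪g t, val (mulOp B R) (dt u t)⟫_ℂ).re = 0 := fun t ht => by
      have h1 : val R (dt u t) = 0 := by
        rw [val, dif_pos (hu.mem_damping t ht)]; exact hR0 _
      rw [B.graph_fst_eq_zero_snd (hBR t ht) h1, inner_zero_right, Complex.zero_re, mul_zero]
    exact ⟨hzero, fun t ht => hasDerivWithinAt_zero_eq_of_nonneg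
      (f := fun s => ‖g s‖ ^ 2 + ‖val (mulOp A B) (u s)‖ ^ 2)
      (fun s hs => hzero s hs ▸ hderiv s hs) ht⟩
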